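/- Let $\mathbb F$ be a finite field, let $1\le k<n$ and $f\ge 1$, and let $\mathcal C$ be an $[n,k]$ linear code over $\mathbb F$ with generator matrix $G$. A set of $k$ coordinates is an information set if the corresponding $k\times k$ submatrix of $G$ is invertible. Suppose that $\mathcal C$ is MDS-PIR capacity-achieving: for some $\kappa,\nu$ with $\nu\ge 1$ and $\kappa/\nu=k/n$ there is a binary $\nu\times n$ matrix each of whose columns has Hamming weight $\kappa$ and such that the support of each of its rows contains an information set of $\mathcal C$. Consider a distributed storage system with $n$ noncolluding nodes storing $f$ files $X^{(1)},\dots,X^{(f)}$, independent and uniformly distributed $\beta\times k$ matrices over $\mathbb F$ ($\beta\ge1$ is chosen by the protocol), where node $l$ stores the $l$-th columns of $X^{(1)}G,\dots,X^{(f)}G$. In a PIR protocol a user who wants file $m$ sends random (discrete) queries $Q^{(m)}_1,\dots,Q^{(m)}_n$, jointly independent of the files, and node $l$ returns a string $A^{(m)}_l$ of symbols of $\mathbb F$ that is a deterministic function of $Q^{(m)}_l$ and of the content of node $l$, and whose length is determined by $Q^{(m)}_l$. The protocol has to satisfy privacy, $I\bigl(m;\,Q^{(m)}_l,A^{(m)}_l,X^{(1)},\dots,X^{(f)}\bigr)=0$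 for every $l$ (whatever the distribution of the index $m$), and recovery, $H\bigl(X^{(m)}\mid A^{(m)}_1,\dots,A^{(m)}_n,Q^{(m)}_1,\dots,Q^{(m)}_n\bigr)=0$ for every $m$. Its rate is $\beta k/D$, where $D$ is the (expected) total number of symbols downloaded to retrieve one file. Then the PIR capacity, i.e. the supremum of the rates of all such protocols, equals the MDS-PIR capacity $$\frac{n-k}{n}\left[1-\Bigl(\frac kn\Bigr)^{f}\right]^{-1},$$ and it is attained, namely by a protocol in which the lengths of the responses are constants (independent of the queries). -/

import Mathlib

open scoped ENNReal

noncomputable section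

/-! ### Information measures of discrete random variables -/

/-- Mutual information (in nats) of the two coordinates of a discrete pair with joint law `p`:
the Kullback-Leibler divergence of the joint law from the product of its marginals. -/
def mutualInfo {α β : Type*} (p : PMF (α × β)) : ℝ≥0∞ :=
  letI : MeasurableSpace α := ⊤
  letI : MeasurableSpace β := ⊤
  InformationTheory.klDiv p.toMeasure
    ((p.map Prod.fst).toMeasure.prod (p.map Prod.snd).toMeasure)

/-- Conditional Shannon entropy `H(U | V)` (in nats) of a discrete pair `(U, V)` with joint
law `p`, where `U` takes finitely many values:
`∑ v, P(V = v) * ∑ u, - P(U = u | V = v) * log P(U = u | V = v)`. -/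
def condEntropy {α β : Type*} [Fintype α] (p : PMF (α × β)) : ℝ≥0∞ :=
  ∑' v : β, (p.map Prod.snd) v *
    ∑ u : α, ENNReal.ofReal (Real.negMulLog (p (u, v) / (p.map Prod.snd) v).toReal)

/-! ### Linear codes and achievable rate matrices -/

/-- `G` is a generator matrix of an `[n, k]` code (its row space): its `k` rows are linearly
independent. -/
def IsGeneratorMatrix {F : Type*} [Field F] {k n : ℕ} (G : Matrix (Fin k) (Fin n) F) : Prop :=
  LinearIndependent F G.row

/-- `I` is an information set: it has `k` elements and the square submatrix of `G` formed by
the columns in `I` is invertible. -/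
def IsInformationSet {F : Type*} [Field F] {k n : ℕ} (G : Matrix (Fin k) (Fin n) F)
    (I : Finset (Fin n)) : Prop :=
  ∃ h : I.card = k, IsUnit (G.submatrix id (I.orderEmbOfFin h))

/-- `Λ` is a PIR achievable rate matrix with parameters `κ`, `ν` for the code generated
by `G`. -/
structure IsPIRAchievableRateMatrix {F : Type*} [Field F] {k n : ℕ}
    (G : Matrix (Fin k) (Fin n) F) (κ ν : ℕ) (Λ : Matrix (Fin ν) (Fin n) Bool) : Prop where
  /-- every column has Hamming weight `κ` -/
  column_weight : ∀ l, (Finset.univ.filter fun i => Λ i l = true).card = κ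
  /-- the support of every row contains an information set -/
  row_support : ∀ i, ∃ I : Finset (Fin n),
    IsInformationSet G I ∧ I ⊆ Finset.univ.filter fun l => Λ i l = true

/-- The code generated by `G` is an MDS-PIR capacity-achieving code. -/
def IsMDSPIRCapacityAchieving {F : Type*} [Field F] {k n : ℕ}
    (G : Matrix (Fin k) (Fin n) F) : Prop :=
  ∃ κ ν : ℕ, 0 < ν ∧ (κ : ℚ) / ν = (k : ℚ) / n ∧
    ∃ Λ : Matrix (Fin ν) (Fin n) Bool, IsPIRAchievableRateMatrix G κ ν Λ

/-- The MDS-PIR capacity `(n - k) / n * [1 - (k / n) ^ f]⁻¹`. -/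
def mdsPIRCapacity (n k f : ℕ) : ℝ :=
  ((n : ℝ) - k) / n * (1 - ((k : ℝ) / n) ^ f)⁻¹

/-! ### PIR protocols -/

/-- The contents of the storage node `l` when the `f` files `X`, each a `β × k` matrix, are
encoded row by row with the generator matrix `G`: the `l`-th column of each of the `f` code
arrays `X m * G`. -/
def nodeContent {F : Type*} [Field F] {k n f β : ℕ} (G : Matrix (Fin k) (Fin n) F)
    (X : Fin f → Matrix (Fin β) (Fin k) F) (l : Fin n) : Fin f → Fin β → F :=
  fun m i => (X m * G) i l

/-- A one-round protocol for a system of `n` nodes that stores `f` files over `F`. -/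
structure PIRProtocol (F : Type*) (n f : ℕ) where
  /-- the number of rows (stripes) of each file -/
  β : ℕ
  β_pos : 0 < β
  /-- the alphabet of the queries sent to node `l` -/
  Query : Fin n → Type
  /-- the joint law of the `n` queries when file `m` is wanted -/
  queryLaw : Fin f → PMF (∀ l, Query l)
  /-- the number of symbols that node `l` sends in reply to a query -/
  respLength : ∀ l, Query l → ℕ
  /-- the response of node `l`, a function of its query and of what it stores -/
  resp : ∀ l, Query l → (Fin f → Fin β → F) → List F
  resp_length : ∀ l q c, (resp l q c).length = respLength l q

namespace PIRProtocol

variable {F : Type*} [Field F] [Fintype F] {k n f : ℕ}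

/-- The joint law of the files and the queries when file `m` is wanted: the files are uniformly
distributed, and the queries are independent of the files. -/
def law (P : PIRProtocol F n f) (k : ℕ) (m : Fin f) :
    PMF ((Fin f → Matrix (Fin P.β) (Fin k) F) × (∀ l, P.Query l)) :=
  (PMF.uniformOfFintype (Fin f → Matrix (Fin P.β) (Fin k) F)).bind fun X =>
    (P.queryLaw m).map fun q => (X, q)

/-- Privacy: for each node `l`, the index of the wanted file (whatever its distribution `π`) has
zero mutual information with the triple (query to node `l`, response of node `l`, all files). -/
def IsPrivate (P : PIRProtocol F n f) (G : Matrix (Fin k) (Fin n) F) : Prop :=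
  ∀ (l : Fin n) (π : PMF (Fin f)),
    mutualInfo (π.bind fun m => (P.law k m).map fun ω =>
      (m, (ω.2 l, P.resp l (ω.2 l) (nodeContent G ω.1 l), ω.1))) = 0

/-- Recovery: given all responses and all queries, the wanted file has zero conditional
entropy. -/
def Recovers (P : PIRProtocol F n f) (G : Matrix (Fin k) (Fin n) F) : Prop :=
  ∀ m : Fin f,
    condEntropy ((P.law k m).map fun ω =>
      (ω.1 m, ((fun l => P.resp l (ω.2 l) (nodeContent G ω.1 l)), ω.2))) = 0

/-- Perfect information-theoretic PIR for the storage code generated by `G`. -/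
def IsPerfectPIR (P : PIRProtocol F n f) (G : Matrix (Fin k) (Fin n) F) : Prop :=
  P.IsPrivate G ∧ P.Recovers G

/-- The number of symbols downloaded to retrieve file `m` (expectation over the queries). -/
def downloadOf (P : PIRProtocol F n f) (m : Fin f) : ℝ≥0∞ :=
  ∑' q : ∀ l, P.Query l, P.queryLaw m q * ∑ l, (P.respLength l (q l) : ℝ≥0∞)

/-- The number of symbols downloaded to retrieve a single file. (For a private protocol it is
the same for all files.) -/
def download (P : PIRProtocol F n f) : ℝ≥0∞ :=
  ⨆ m, P.downloadOf m

/-- The PIR rate: number of symbols of a file per downloaded symbol. -/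
def rate (P : PIRProtocol F n f) (k : ℕ) : ℝ≥0∞ :=
  ((P.β * k : ℕ) : ℝ≥0∞) / P.download

/-- The lengths of the responses are constants, not depending on the queries. -/
def HasConstantLengths (P : PIRProtocol F n f) : Prop :=
  ∃ d : Fin n → ℕ, ∀ l q, P.respLength l q = d l

end PIRProtocol

/-- The PIR capacity for `f` files stored with the code generated by `G`: the supremum of the
rates of all protocols that achieve perfect PIR. -/
def pirCapacity {F : Type*} [Field F] [Fintype F] {k n : ℕ} (G : Matrix (Fin k) (Fin n) F)
    (f : ℕ) : ℝ≥0∞ :=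
  sSup {R | ∃ P : PIRProtocol F n f, P.IsPerfectPIR G ∧ R = P.rate k}

end

noncomputable section

/-! Equality in a double count shows that the rows of the rate matrix are exactly information sets
`I i`, `i < ν`, with every node in exactly `κ` of them, where `κ * n = k * ν`. Both halves of the
proof use only these sets.

Converse (`rate_le`). Fix queries for the wanted file `j` and condition on the files before `j`. The
sum of the single-node response entropies is at least the joint entropy. By recovery the joint
entropy is the entropy of one file plus the joint entropy given file `j` as well. The contents of
the nodes in an information set are independent, so averaging over the `I i` bounds this last term
below by `κ / ν = k / n` times the sum of single-node entropies (`sum_condEnt_response_ge`). After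
averaging over queries, privacy makes these sums independent of the wanted file, so the steps chain
over `j` and the download is at least `β * k * ∑ i < f, (k / n) ^ i`.

Achievability (`stripeProtocol`). Each response symbol is a sum of stored symbols from several
files. The permutations `τ l` send the rows containing node `l` to the numbers below `κ`. Twisting
the labels by `τ l` in coordinate `m` aligns the interference from the other files into one codeword
shared by all nodes. The nodes of one `I i` return that codeword without any term of file `m`, so it
can be decoded and removed elsewhere (`eq_zero_of_stripeAnswer_eq_zero`). Uniformly random
labellings hide the twist from each single node. -/

/-! ### Vanishing of mutual information and of conditional entropy. -/

theorem PMF.bind_map_prodMk_apply {α β : Type*} (π : PMF α) (K : α → PMF β) (a : α) (b : β) :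
    (π.bind fun a => (K a).map (Prod.mk a)) (a, b) = π a * K a b := by
  classical
  rw [PMF.bind_apply, tsum_eq_single a]
  · congr 1
    rw [PMF.map_apply, tsum_eq_single b]
    · simp
    · intro b' hb'
      simp [hb'.symm]
  · intro a' ha'
    simp [PMF.map_apply, ha'.symm]

theorem PMF.map_snd_bind_map_prodMk {α β : Type*} (π : PMF α) (K : α → PMF β) :
    (π.bind fun a => (K a).map (Prod.mk a)).map Prod.snd = π.bind K := by
  rw [PMF.map_bind]
  congr 1
  funext a
  rw [PMF.map_comp]
  exact PMF.map_id _

theorem PMF.map_fst_bind_map_prodMk {α β : Type*} (π : PMF α) (K : α → PMF β) :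
    (π.bind fun a => (K a).map (Prod.mk a)).map Prod.fst = π := by
  rw [PMF.map_bind]
  conv_rhs => rw [← PMF.bind_pure π]
  congr 1
  funext a
  rw [PMF.map_comp]
  exact PMF.map_const _ a

/-- Mutual information vanishes if and only if the joint law is the product of its marginals. -/
theorem mutualInfo_eq_zero_iff {α β : Type*} (p : PMF (α × β)) :
    mutualInfo p = 0 ↔ ∀ a b, p (a, b) = p.map Prod.fst a * p.map Prod.snd b := by
  let _ : MeasurableSpace α := ⊤
  let _ : MeasurableSpace β := ⊤
  unfold mutualInfo
  rw [InformationTheory.klDiv_eq_zero_iff]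
  constructor
  · intro h a b
    have := congrArg (fun μ => μ ({a} ×ˢ {b})) h
    simp only [MeasureTheory.Measure.prod_prod] at this
    rw [PMF.toMeasure_apply_singleton _ _ (MeasurableSpace.measurableSet_top),
      PMF.toMeasure_apply_singleton _ _ (MeasurableSpace.measurableSet_top),
      Set.singleton_prod_singleton, PMF.toMeasure_apply_singleton] at this
    · exact this
    · rw [← Set.singleton_prod_singleton]
      exact (MeasurableSpace.measurableSet_top).prod (MeasurableSpace.measurableSet_top)
  · intro h
    symm
    apply MeasureTheory.Measure.prod_eq
    intro s t hs ht
    rw [PMF.toMeasure_apply _ (hs.prod ht), PMF.toMeasure_apply _ hs, PMF.toMeasure_apply _ ht,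
      ENNReal.tsum_prod', ← ENNReal.tsum_mul_right]
    congr 1
    funext a
    rw [← ENNReal.tsum_mul_left]
    congr 1
    funext b
    by_cases ha : a ∈ s <;> by_cases hb : b ∈ t <;> simp [ha, hb, h a b]

theorem mutualInfo_bind_eq_zero_iff {α β : Type*} (π : PMF α) (K : α → PMF β) :
    mutualInfo (π.bind fun a => (K a).map (Prod.mk a)) = 0 ↔
      ∀ a b, π a * K a b = π a * π.bind K b := by
  simp only [mutualInfo_eq_zero_iff, PMF.map_snd_bind_map_prodMk, PMF.map_fst_bind_map_prodMk,
    PMF.bind_map_prodMk_apply]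

theorem PMF.map_snd_apply {α β : Type*} [Fintype α] (p : PMF (α × β)) (b : β) :
    p.map Prod.snd b = ∑ a, p (a, b) := by
  classical
  rw [PMF.map_apply, ENNReal.tsum_prod', tsum_fintype]
  refine Finset.sum_congr rfl fun a _ => ?_
  rw [tsum_eq_single b]
  · simp
  · intro b' hb'
    simp [hb'.symm]

/-- The conditional entropy `H(U | V)` vanishes if and only if `V` determines `U`. -/
theorem condEntropy_eq_zero_iff {α β : Type*} [Fintype α] (p : PMF (α × β)) :
    condEntropy p = 0 ↔ ∀ v u u', p (u, v) ≠ 0 → p (u', v) ≠ 0 → u = u' := by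
  classical
  unfold condEntropy
  simp only [ENNReal.tsum_eq_zero, mul_eq_zero, Finset.sum_eq_zero_iff, Finset.mem_univ,
    true_implies, ENNReal.ofReal_eq_zero]
  refine forall_congr' fun v => ?_
  have hle : ∀ u, p (u, v) ≤ p.map Prod.snd v := fun u => by
    rw [PMF.map_snd_apply]
    exact Finset.single_le_sum (f := fun u => p (u, v)) (fun _ _ => zero_le) (Finset.mem_univ u)
  have htop : p.map Prod.snd v ≠ ∞ := PMF.apply_ne_top _ _
  constructor
  · rintro (h | h) u u' hu hu'
    · exact absurd (le_antisymm ((hle u).trans h.le) zero_le) hu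
    · by_contra hne
      have h0 : p.map Prod.snd v ≠ 0 := fun h0 =>
        hu (le_antisymm ((hle u).trans h0.le) zero_le)
      -- A second value of positive mass puts the conditional probability of `u` strictly between 0
      -- and 1, where `Real.negMulLog` is positive.
      have hlt : p (u, v) < p.map Prod.snd v := by
        have h2 : p (u, v) + p (u', v) ≤ p.map Prod.snd v := by
          rw [PMF.map_snd_apply, ← Finset.sum_pair (f := fun u => p (u, v)) hne]
          exact Finset.sum_le_sum_of_subset (Finset.subset_univ _)
        exact (ENNReal.lt_add_right (PMF.apply_ne_top _ _) hu').trans_le h2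
      have hr0 : 0 < (p (u, v) / p.map Prod.snd v).toReal :=
        ENNReal.toReal_pos (ENNReal.div_pos hu htop).ne'
          (ENNReal.div_lt_top (PMF.apply_ne_top _ _) h0).ne
      have hr1 : (p (u, v) / p.map Prod.snd v).toReal < 1 := by
        rw [← ENNReal.toReal_one]
        refine (ENNReal.toReal_lt_toReal (ENNReal.div_lt_top (PMF.apply_ne_top _ _) h0).ne
          ENNReal.one_ne_top).2 ?_
        rw [ENNReal.div_lt_iff (Or.inl h0) (Or.inl htop), one_mul]
        exact hlt
      have := h u
      rw [Real.negMulLog, neg_mul] at this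
      nlinarith [Real.log_neg hr0 hr1]
  · intro h
    by_cases hv : p.map Prod.snd v = 0
    · exact Or.inl hv
    refine Or.inr fun u => ?_
    by_cases hu : p (u, v) = 0
    · simp [hu]
    have : p.map Prod.snd v = p (u, v) := by
      rw [PMF.map_snd_apply]
      refine Finset.sum_eq_single u (fun u' _ hne => ?_) (by simp)
      by_contra hu'
      exact hne (h u' u hu' hu)
    rw [this, ENNReal.div_self hu (PMF.apply_ne_top _ _)]
    simp

/-! ### Privacy and recovery as conditions on the query laws. -/

namespace PIRProtocol

variable {F : Type*} [Field F] [Fintype F] {k n f : ℕ}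

theorem law_ne_zero_iff (P : PIRProtocol F n f) (m : Fin f)
    (ω : (Fin f → Matrix (Fin P.β) (Fin k) F) × (∀ l, P.Query l)) :
    P.law k m ω ≠ 0 ↔ P.queryLaw m ω.2 ≠ 0 := by
  rw [← PMF.mem_support_iff, ← PMF.mem_support_iff, law]
  simp only [PMF.mem_support_bind_iff, PMF.mem_support_map_iff, PMF.support_uniformOfFintype]
  constructor
  · rintro ⟨X, -, q, hq, rfl⟩
    exact hq
  · intro h
    exact ⟨ω.1, trivial, ω.2, h, rfl⟩

/-- Recovery means that the responses to any queries that may occur determine the wanted file. -/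
theorem recovers_iff (P : PIRProtocol F n f) (G : Matrix (Fin k) (Fin n) F) :
    P.Recovers G ↔ ∀ m q, P.queryLaw m q ≠ 0 →
      ∀ X X' : Fin f → Matrix (Fin P.β) (Fin k) F,
        (∀ l, P.resp l (q l) (nodeContent G X l) = P.resp l (q l) (nodeContent G X' l)) →
          X m = X' m := by
  unfold Recovers
  refine forall_congr' fun m => ?_
  rw [condEntropy_eq_zero_iff]
  simp only [← PMF.mem_support_iff, PMF.mem_support_map_iff]
  constructor
  · intro h q hq X X' hX
    refine h (fun l => P.resp l (q l) (nodeContent G X l), q) (X m) (X' m)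
      ⟨(X, q), ?_, rfl⟩ ⟨(X', q), ?_, ?_⟩
    · exact (law_ne_zero_iff P m _).2 hq
    · exact (law_ne_zero_iff P m _).2 hq
    · simp [hX]
  · rintro h ⟨a, q⟩ u u' ⟨⟨X, q1⟩, h1, h1'⟩ ⟨⟨X', q2⟩, h2, h2'⟩
    simp only [Prod.mk.injEq] at h1' h2'
    obtain ⟨rfl, rfl, rfl⟩ := h1'
    obtain ⟨rfl, h3, rfl⟩ := h2'
    exact h q2 ((law_ne_zero_iff P m _).1 h1) X X' fun l => (congrFun h3 l).symm

/-- The law of the query to a single node. -/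
def nodeQueryLaw (P : PIRProtocol F n f) (m : Fin f) (l : Fin n) : PMF (P.Query l) :=
  (P.queryLaw m).map fun q => q l

theorem law_map_node (P : PIRProtocol F n f) (G : Matrix (Fin k) (Fin n) F) (m : Fin f)
    (l : Fin n) :
    (P.law k m).map (fun ω => (ω.2 l, P.resp l (ω.2 l) (nodeContent G ω.1 l), ω.1)) =
      (PMF.uniformOfFintype (Fin f → Matrix (Fin P.β) (Fin k) F)).bind fun X =>
        (P.nodeQueryLaw m l).map fun ql => (ql, P.resp l ql (nodeContent G X l), X) := by
  unfold law nodeQueryLaw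
  rw [PMF.map_bind]
  congr 1
  funext X
  rw [PMF.map_comp, PMF.map_comp]
  rfl

/-- Files are independent of queries and a response is a function of query and content, so the law
of the whole triple depends on the wanted file only through the query law at the node. -/
theorem isPrivate_iff (P : PIRProtocol F n f) (G : Matrix (Fin k) (Fin n) F) :
    P.IsPrivate G ↔ ∀ l m m', P.nodeQueryLaw m l = P.nodeQueryLaw m' l := by
  set K : ∀ l : Fin n, Fin f →
      PMF (P.Query l × List F × (Fin f → Matrix (Fin P.β) (Fin k) F)) := fun l m => (P.law k m).map
    (fun ω => (ω.2 l, P.resp l (ω.2 l) (nodeContent G ω.1 l), ω.1)) with hK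
  have hfst : ∀ l m, (K l m).map Prod.fst = P.nodeQueryLaw m l := fun l m => by
    rw [hK]
    simp only
    rw [law_map_node, PMF.map_bind]
    conv_rhs => rw [← PMF.bind_const (PMF.uniformOfFintype (Fin f → Matrix (Fin P.β) (Fin k) F))
      (P.nodeQueryLaw m l)]
    congr 1
    funext X
    rw [PMF.map_comp]
    exact PMF.map_id _
  have hpriv : P.IsPrivate G ↔ ∀ l (π : PMF (Fin f)),
      ∀ a b, π a * K l a b = π a * π.bind (K l) b := by
    unfold IsPrivate
    refine forall_congr' fun l => forall_congr' fun π => ?_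
    rw [← mutualInfo_bind_eq_zero_iff]
    simp only [hK, PMF.map_comp]
    rfl
  rw [hpriv]
  constructor
  · intro h l m m'
    have : Nonempty (Fin f) := ⟨m⟩
    -- A uniform index charges every file, so its factor can be cancelled.
    have key : ∀ a, K l a = (PMF.uniformOfFintype (Fin f)).bind (K l) := fun a => by
      ext b
      have h1 := h l (PMF.uniformOfFintype (Fin f)) a b
      refine (ENNReal.mul_right_inj ?_ (PMF.apply_ne_top _ _)).1 h1
      exact (PMF.mem_support_iff _ _).1 (PMF.mem_support_uniformOfFintype a)
    rw [← hfst l m, ← hfst l m', key m, ← key m']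
  · intro h l π a b
    have : ∀ m, K l m = K l a := fun m => by
      simp only [hK]
      rw [law_map_node, law_map_node, h l m a]
    rw [show K l = fun _ => K l a from funext this, PMF.bind_const]

end PIRProtocol

/-! ### Entropy of functions on a finite uniform probability space -/

namespace UniformEntropy

open scoped Classical in
/-- The number of points at which `Z` takes the value `z`. -/
def fiberCard {Ω T : Type*} [Fintype Ω] (Z : Ω → T) (z : T) : ℕ :=
  (Finset.univ.filter fun ω => Z ω = z).card

/-- The conditional entropy `H(Y | Z)` (in nats) of two functions on a finite set that carries the
uniform distribution. -/
def condEnt {Ω S T : Type*} [Fintype Ω] (Y : Ω → S) (Z : Ω → T) : ℝ :=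
  (∑ ω, (Real.log (fiberCard Z (Z ω)) -
    Real.log (fiberCard (fun ω => (Z ω, Y ω)) (Z ω, Y ω)))) / Fintype.card Ω

variable {Ω Ω' S S' S₁ S₂ T T' : Type*} [Fintype Ω] [Fintype Ω']

theorem fiberCard_pos (Z : Ω → T) (ω : Ω) : 0 < fiberCard Z (Z ω) := by
  classical
  exact Finset.card_pos.2 ⟨ω, by simp⟩

theorem fiberCard_le_of_imp {Z : Ω → T} {Z' : Ω → T'} {ω : Ω}
    (h : ∀ ω', Z ω' = Z ω → Z' ω' = Z' ω) : fiberCard Z (Z ω) ≤ fiberCard Z' (Z' ω) := by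
  classical
  unfold fiberCard
  refine Finset.card_le_card fun ω' => ?_
  simpa using h ω'

theorem fiberCard_congr {Z : Ω → T} {Z' : Ω → T'} {ω : Ω}
    (h : ∀ ω', Z ω' = Z ω ↔ Z' ω' = Z' ω) : fiberCard Z (Z ω) = fiberCard Z' (Z' ω) :=
  le_antisymm (fiberCard_le_of_imp fun ω' => (h ω').1) (fiberCard_le_of_imp fun ω' => (h ω').2)

theorem log_fiberCard_le_of_imp {Z : Ω → T} {Z' : Ω → T'} {ω : Ω}
    (h : ∀ ω', Z ω' = Z ω → Z' ω' = Z' ω) :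
    Real.log (fiberCard Z (Z ω)) ≤ Real.log (fiberCard Z' (Z' ω)) :=
  Real.log_le_log (by exact_mod_cast fiberCard_pos Z ω) (by exact_mod_cast fiberCard_le_of_imp h)

theorem condEnt_nonneg (Y : Ω → S) (Z : Ω → T) : 0 ≤ condEnt Y Z := by
  refine div_nonneg (Finset.sum_nonneg fun ω _ => sub_nonneg.2 ?_) (Nat.cast_nonneg _)
  refine log_fiberCard_le_of_imp (Z := fun ω => (Z ω, Y ω)) fun ω' h => ?_
  exact (Prod.mk.inj h).1

theorem condEnt_mono {Y : Ω → S} {Y' : Ω → S'} {Z : Ω → T}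
    (h : ∀ ω ω', Y ω = Y ω' → Y' ω = Y' ω') : condEnt Y' Z ≤ condEnt Y Z := by
  refine div_le_div_of_nonneg_right (Finset.sum_le_sum fun ω _ => sub_le_sub_left ?_ _)
    (Nat.cast_nonneg _)
  refine log_fiberCard_le_of_imp (Z := fun ω => (Z ω, Y ω)) (Z' := fun ω => (Z ω, Y' ω))
    fun ω' h' => ?_
  rw [Prod.mk.injEq] at h' ⊢
  exact ⟨h'.1, h _ _ h'.2⟩

theorem condEnt_congr {Y : Ω → S} {Y' : Ω → S'} {Z : Ω → T} {Z' : Ω → T'}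
    (hY : ∀ ω ω', Y ω = Y ω' ↔ Y' ω = Y' ω') (hZ : ∀ ω ω', Z ω = Z ω' ↔ Z' ω = Z' ω') :
    condEnt Y Z = condEnt Y' Z' := by
  unfold condEnt
  congr 1
  refine Finset.sum_congr rfl fun ω _ => ?_
  rw [fiberCard_congr (Z := Z) (Z' := Z') fun ω' => hZ ω' ω,
    fiberCard_congr (Z := fun ω => (Z ω, Y ω)) (Z' := fun ω => (Z' ω, Y' ω)) fun ω' => by
      simp only [Prod.mk.injEq, hZ, hY]]

theorem condEnt_const (s : S) (Z : Ω → T) : condEnt (fun _ => s) Z = 0 := by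
  unfold condEnt
  rw [div_eq_zero_iff]
  refine Or.inl (Finset.sum_eq_zero fun ω _ => ?_)
  rw [fiberCard_congr (Z := fun ω => (Z ω, s)) (Z' := Z) fun ω' => by simp, sub_self]

theorem fiberCard_comp_equiv (e : Ω ≃ Ω') (Z : Ω' → T) (z : T) :
    fiberCard (fun ω => Z (e ω)) z = fiberCard Z z := by
  classical
  unfold fiberCard
  refine Finset.card_bij (fun ω _ => e ω) (by simp) (by simp) fun ω' h => ⟨e.symm ω', ?_, by simp⟩
  simpa using h

theorem condEnt_comp_equiv (e : Ω ≃ Ω') (Y : Ω' → S) (Z : Ω' → T) :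
    condEnt (fun ω => Y (e ω)) (fun ω => Z (e ω)) = condEnt Y Z := by
  unfold condEnt
  rw [Fintype.card_congr e]
  congr 1
  refine Fintype.sum_equiv e _ _ fun ω => ?_
  rw [fiberCard_comp_equiv e Z, fiberCard_comp_equiv e (fun ω => (Z ω, Y ω))]

theorem sum_div_fiberCard [DecidableEq T] (W : Ω → T) (h : T → ℝ) :
    ∑ ω, h (W ω) / fiberCard W (W ω) = ∑ w ∈ Finset.univ.image W, h w := by
  classical
  rw [Finset.sum_comp (fun w => h w / fiberCard W w) W]
  refine Finset.sum_congr rfl fun w hw => ?_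
  obtain ⟨ω, -, rfl⟩ := Finset.mem_image.1 hw
  have h1 : (Finset.univ.filter fun ω' => W ω' = W ω).card = fiberCard W (W ω) := by
    unfold fiberCard
    congr
  have h2 : (fiberCard W (W ω) : ℝ) ≠ 0 := by exact_mod_cast (fiberCard_pos W ω).ne'
  rw [h1, nsmul_eq_mul]
  field_simp

theorem sum_fiberCard [DecidableEq T] (Z : Ω → T) :
    ∑ z ∈ Finset.univ.image Z, (fiberCard Z z : ℝ) = Fintype.card Ω := by
  rw [← sum_div_fiberCard]
  rw [Finset.sum_congr rfl fun ω _ =>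
    div_self (show (fiberCard Z (Z ω) : ℝ) ≠ 0 by exact_mod_cast (fiberCard_pos Z ω).ne')]
  simp

theorem sum_fiberCard_prod [DecidableEq S] (Y : Ω → S) (Z : Ω → T) (z : T) :
    ∑ y ∈ Finset.univ.image Y, (fiberCard (fun ω => (Z ω, Y ω)) (z, y) : ℝ) = fiberCard Z z := by
  classical
  rw [← Nat.cast_sum]
  congr 1
  unfold fiberCard
  rw [Finset.card_eq_sum_card_fiberwise (f := Y) (t := Finset.univ.image Y)
    (fun ω _ => by simp)]
  refine Finset.sum_congr rfl fun y _ => ?_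
  rw [Finset.filter_filter]
  congr 1
  ext ω
  simp

/-- Gibbs' inequality: `log x ≤ x - 1` is applied to the ratio of `N(z) / |S|` to `N(z, y)`, with
`N` the fibre sizes. Summing the ratio over points leaves a sum over attained pairs, which is at
most `|Ω|`. -/
theorem condEnt_le_log_card [Fintype S] [Nonempty Ω] (Y : Ω → S) (Z : Ω → T) :
    condEnt Y Z ≤ Real.log (Fintype.card S) := by
  classical
  have hΩ : (0 : ℝ) < Fintype.card Ω := by exact_mod_cast Fintype.card_pos
  have hS : (0 : ℝ) < Fintype.card S := by
    have : Nonempty S := ⟨Y (Classical.arbitrary Ω)⟩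
    exact_mod_cast Fintype.card_pos
  unfold condEnt
  rw [div_le_iff₀ hΩ]
  set W := fun ω => (Z ω, Y ω) with hW
  have hN : ∀ ω, (0 : ℝ) < fiberCard Z (Z ω) := fun ω => by exact_mod_cast fiberCard_pos Z ω
  have hNW : ∀ ω, (0 : ℝ) < fiberCard W (Z ω, Y ω) := fun ω => by
    exact_mod_cast fiberCard_pos W ω
  have hterm : ∀ ω, Real.log (fiberCard Z (Z ω)) - Real.log (fiberCard W (Z ω, Y ω)) ≤
      Real.log (Fintype.card S) +
        ((fiberCard Z (Z ω) / Fintype.card S : ℝ) / fiberCard W (Z ω, Y ω) - 1) := fun ω => by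
    have h1 := Real.log_le_sub_one_of_pos (div_pos (div_pos (hN ω) hS) (hNW ω))
    rw [Real.log_div (div_pos (hN ω) hS).ne' (hNW ω).ne', Real.log_div (hN ω).ne' hS.ne'] at h1
    linarith
  refine (Finset.sum_le_sum fun ω _ => hterm ω).trans ?_
  rw [Finset.sum_add_distrib, Finset.sum_sub_distrib]
  have h2 := sum_div_fiberCard W fun w => (fiberCard Z w.1 : ℝ) / Fintype.card S
  simp only [hW] at h2 ⊢
  rw [h2]
  have h3 : ∑ w ∈ Finset.univ.image fun ω => (Z ω, Y ω),
      (fiberCard Z w.1 : ℝ) / Fintype.card S ≤ Fintype.card Ω := by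
    calc _ ≤ ∑ w ∈ Finset.univ.image Z ×ˢ (Finset.univ : Finset S),
          (fiberCard Z w.1 : ℝ) / Fintype.card S := by
            refine Finset.sum_le_sum_of_subset_of_nonneg (fun w hw => ?_)
              fun _ _ _ => by positivity
            obtain ⟨ω, -, rfl⟩ := Finset.mem_image.1 hw
            simp
      _ = Fintype.card Ω := by
            rw [Finset.sum_product, ← sum_fiberCard Z]
            refine Finset.sum_congr rfl fun z _ => ?_
            simp only [Finset.sum_const, Finset.card_univ, nsmul_eq_mul]
            field_simp
  simp only [Finset.sum_const, Finset.card_univ, nsmul_eq_mul]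
  linarith

/-- The same use of `log x ≤ x - 1`, now comparing `N(z, y₁, y₂)` with its conditionally independent
counterpart `N(z, y₁) * N(z, y₂) / N(z)`. -/
theorem condEnt_prodMk_le (Y₁ : Ω → S₁) (Y₂ : Ω → S₂) (Z : Ω → T) :
    condEnt (fun ω => (Y₁ ω, Y₂ ω)) Z ≤ condEnt Y₁ Z + condEnt Y₂ Z := by
  classical
  unfold condEnt
  rw [← add_div]
  refine div_le_div_of_nonneg_right ?_ (Nat.cast_nonneg _)
  rw [← Finset.sum_add_distrib]
  set W₁ := fun ω => (Z ω, Y₁ ω) with hW₁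
  set W₂ := fun ω => (Z ω, Y₂ ω) with hW₂
  set W := fun ω => (Z ω, (Y₁ ω, Y₂ ω)) with hW
  have hN : ∀ ω, (0 : ℝ) < fiberCard Z (Z ω) := fun ω => by exact_mod_cast fiberCard_pos Z ω
  have hN₁ : ∀ ω, (0 : ℝ) < fiberCard W₁ (Z ω, Y₁ ω) := fun ω => by
    exact_mod_cast fiberCard_pos W₁ ω
  have hN₂ : ∀ ω, (0 : ℝ) < fiberCard W₂ (Z ω, Y₂ ω) := fun ω => by
    exact_mod_cast fiberCard_pos W₂ ω
  have hNW : ∀ ω, (0 : ℝ) < fiberCard W (Z ω, (Y₁ ω, Y₂ ω)) := fun ω => by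
    exact_mod_cast fiberCard_pos W ω
  have hterm : ∀ ω, Real.log (fiberCard Z (Z ω)) - Real.log (fiberCard W (Z ω, (Y₁ ω, Y₂ ω))) ≤
      (Real.log (fiberCard Z (Z ω)) - Real.log (fiberCard W₁ (Z ω, Y₁ ω)) +
        (Real.log (fiberCard Z (Z ω)) - Real.log (fiberCard W₂ (Z ω, Y₂ ω)))) +
        ((fiberCard W₁ (Z ω, Y₁ ω) * fiberCard W₂ (Z ω, Y₂ ω) / fiberCard Z (Z ω) : ℝ) /
          fiberCard W (Z ω, (Y₁ ω, Y₂ ω)) - 1) := fun ω => by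
    have h1 := Real.log_le_sub_one_of_pos
      (div_pos (div_pos (mul_pos (hN₁ ω) (hN₂ ω)) (hN ω)) (hNW ω))
    rw [Real.log_div (div_pos (mul_pos (hN₁ ω) (hN₂ ω)) (hN ω)).ne' (hNW ω).ne',
      Real.log_div (mul_pos (hN₁ ω) (hN₂ ω)).ne' (hN ω).ne',
      Real.log_mul (hN₁ ω).ne' (hN₂ ω).ne'] at h1
    linarith
  refine (Finset.sum_le_sum fun ω _ => hterm ω).trans ?_
  rw [Finset.sum_add_distrib (g := fun ω => (_ : ℝ) - 1), Finset.sum_sub_distrib (g := fun _ => 1)]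
  have h2 := sum_div_fiberCard W fun w => (fiberCard W₁ (w.1, w.2.1) : ℝ) *
    fiberCard W₂ (w.1, w.2.2) / fiberCard Z w.1
  simp only [hW] at h2 ⊢
  rw [h2]
  have h3 : ∑ w ∈ Finset.univ.image fun ω => (Z ω, (Y₁ ω, Y₂ ω)),
      (fiberCard W₁ (w.1, w.2.1) : ℝ) * fiberCard W₂ (w.1, w.2.2) / fiberCard Z w.1 ≤
        Fintype.card Ω := by
    calc _ ≤ ∑ w ∈ Finset.univ.image Z ×ˢ (Finset.univ.image Y₁ ×ˢ Finset.univ.image Y₂),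
          (fiberCard W₁ (w.1, w.2.1) : ℝ) * fiberCard W₂ (w.1, w.2.2) / fiberCard Z w.1 := by
            refine Finset.sum_le_sum_of_subset_of_nonneg (fun w hw => ?_)
              fun _ _ _ => by positivity
            obtain ⟨ω, -, rfl⟩ := Finset.mem_image.1 hw
            simp
      _ = Fintype.card Ω := by
            rw [Finset.sum_product, ← sum_fiberCard Z]
            refine Finset.sum_congr rfl fun z hz => ?_
            obtain ⟨ω, -, rfl⟩ := Finset.mem_image.1 hz
            rw [Finset.sum_product]
            simp only [← Finset.sum_div]
            rw [← Finset.sum_mul_sum, sum_fiberCard_prod Y₁ Z, sum_fiberCard_prod Y₂ Z]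
            have := (hN ω).ne'
            field_simp
  simp only [Finset.sum_const, Finset.card_univ, nsmul_eq_mul]
  linarith

theorem condEnt_pi_le {ι : Type*} [Fintype ι] (Y : ι → Ω → S) (Z : Ω → T) :
    condEnt (fun ω i => Y i ω) Z ≤ ∑ i, condEnt (Y i) Z := by
  classical
  -- Masking the coordinates outside `s` by `none` keeps the codomain fixed during the induction.
  suffices h : ∀ s : Finset ι, condEnt (fun ω i => if i ∈ s then some (Y i ω) else none) Z ≤
      ∑ i ∈ s, condEnt (Y i) Z by
    refine le_trans (condEnt_mono fun ω ω' h' => ?_) (h Finset.univ)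
    simpa [funext_iff] using h'
  intro s
  induction s using Finset.induction_on with
  | empty => simp [condEnt_const]
  | insert a s ha ih =>
    rw [Finset.sum_insert ha]
    refine le_trans (le_trans (condEnt_mono fun ω ω' h' => ?_)
      (condEnt_prodMk_le (Y a) (fun ω i => if i ∈ s then some (Y i ω) else none) Z))
      (add_le_add_right ih _)
    rw [Prod.mk.injEq] at h'
    funext i
    have h2 := congrFun h'.2 i
    by_cases hi : i = a
    · subst hi
      simp [h'.1]
    · simpa [Finset.mem_insert, hi] using h2

theorem average_apply_pi {ι : Type*} [Fintype ι] [DecidableEq ι] [Nonempty Ω] (i : ι)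
    (φ : Ω → ℝ) :
    (∑ c : ι → Ω, φ (c i)) / Fintype.card (ι → Ω) = (∑ x, φ x) / Fintype.card Ω := by
  have h : ∑ c : ι → Ω, φ (c i) =
      (∑ x, φ x) * Fintype.card ({j // j ≠ i} → Ω) := by
    rw [Fintype.sum_equiv (Equiv.funSplitAt i Ω) (fun c => φ (c i)) (fun p => φ p.1)
      (fun c => rfl), Fintype.sum_prod_type, Finset.sum_mul]
    refine Finset.sum_congr rfl fun x _ => ?_
    simp only [Finset.sum_const, Finset.card_univ, nsmul_eq_mul]
    ring
  rw [h, Fintype.card_congr (Equiv.funSplitAt i Ω), Fintype.card_prod, Nat.cast_mul]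
  rw [mul_div_mul_right]
  exact_mod_cast Fintype.card_ne_zero

theorem fiberCard_pi {ι : Type*} [Fintype ι] [DecidableEq ι] (Z : ι → Ω → T) (z : ι → T) :
    fiberCard (fun (c : ι → Ω) i => Z i (c i)) z = ∏ i, fiberCard (Z i) (z i) := by
  classical
  unfold fiberCard
  rw [← Fintype.card_piFinset]
  congr 1
  ext c
  simp [funext_iff, Fintype.mem_piFinset]

/-- Conditional entropy is additive over independent components. -/
theorem condEnt_pi {ι : Type*} [Fintype ι] [DecidableEq ι] [Nonempty Ω] (Y : ι → Ω → S) (Z : ι → Ω → T) :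
    condEnt (fun (c : ι → Ω) i => Y i (c i)) (fun (c : ι → Ω) i => Z i (c i)) =
      ∑ i, condEnt (Y i) (Z i) := by
  classical
  unfold condEnt
  have h : ∀ c : ι → Ω,
      Real.log (fiberCard (fun (c : ι → Ω) i => Z i (c i)) fun i => Z i (c i)) -
        Real.log (fiberCard (fun (c : ι → Ω) => (fun i => Z i (c i), fun i => Y i (c i)))
          (fun i => Z i (c i), fun i => Y i (c i))) =
      ∑ i, (Real.log (fiberCard (Z i) (Z i (c i))) -
        Real.log (fiberCard (fun x => (Z i x, Y i x)) (Z i (c i), Y i (c i)))) := fun c => by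
    rw [fiberCard_congr (Z := fun (c : ι → Ω) => (fun i => Z i (c i), fun i => Y i (c i)))
      (Z' := fun (c : ι → Ω) i => (Z i (c i), Y i (c i)))
      (fun c' => by simp [funext_iff, forall_and])]
    rw [fiberCard_pi Z, fiberCard_pi (fun i x => (Z i x, Y i x)), Nat.cast_prod, Nat.cast_prod,
      Real.log_prod fun i _ => ?_, Real.log_prod fun i _ => ?_, Finset.sum_sub_distrib]
    · exact_mod_cast (fiberCard_pos (fun x => (Z i x, Y i x)) (c i)).ne'
    · exact_mod_cast (fiberCard_pos (Z i) (c i)).ne'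
  rw [Finset.sum_congr rfl fun c _ => h c, Finset.sum_comm, Finset.sum_div]
  exact Finset.sum_congr rfl fun i _ => average_apply_pi i fun x =>
    Real.log (fiberCard (Z i) (Z i x)) - Real.log (fiberCard (fun x => (Z i x, Y i x)) (Z i x, Y i x))

end UniformEntropy

/-! ### Information sets -/

theorem IsInformationSet.eq_of_columns_eq {F : Type*} [Field F] {k n β : ℕ}
    {G : Matrix (Fin k) (Fin n) F} {I : Finset (Fin n)} (hI : IsInformationSet G I)
    {M M' : Matrix (Fin β) (Fin k) F} (h : ∀ l ∈ I, ∀ r, (M * G) r l = (M' * G) r l) : M = M' := by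
  obtain ⟨hc, u, hu⟩ := hI
  have h1 : M * u.val = M' * u.val := by
    rw [hu]
    ext r s
    exact h (I.orderEmbOfFin hc s) (Finset.orderEmbOfFin_mem I hc s) r
  have h2 := congrArg (· * u⁻¹.val) h1
  simpa only [Matrix.mul_assoc, u.mul_inv, Matrix.mul_one] using h2

/-- The rows of an achievable rate matrix with `κ / ν = k / n` are information sets. -/
theorem IsMDSPIRCapacityAchieving.exists_informationSets {F : Type*} [Field F] {k n : ℕ}
    {G : Matrix (Fin k) (Fin n) F} (hn : 0 < n) (hC : IsMDSPIRCapacityAchieving G) :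
    ∃ κ ν : ℕ, 0 < ν ∧ κ * n = k * ν ∧ ∃ I : Fin ν → Finset (Fin n),
      (∀ i, IsInformationSet G (I i)) ∧
        ∀ l, (Finset.univ.filter fun i => l ∈ I i).card = κ := by
  obtain ⟨κ, ν, hν, hκν, Λ, hΛ⟩ := hC
  have hmul : κ * n = k * ν := by
    have h1 : (ν : ℚ) ≠ 0 := by positivity
    have h2 : (n : ℚ) ≠ 0 := by positivity
    rw [div_eq_div_iff h1 h2] at hκν
    exact_mod_cast hκν
  choose I hI hsub using hΛ.row_support
  refine ⟨κ, ν, hν, hmul, I, hI, ?_⟩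
  -- The matrix has `n * κ = ν * k` ones in all, just enough for `k` in each row, so no support
  -- exceeds its information set.
  have hsum : ∑ i, (I i).card = ∑ i, (Finset.univ.filter fun l => Λ i l = true).card := by
    have h1 : ∀ i, (I i).card = k := fun i => (hI i).1
    have h2 : ∑ i, (Finset.univ.filter fun l => Λ i l = true).card =
        ∑ l, (Finset.univ.filter fun i => Λ i l = true).card := by
      simp only [Finset.card_filter]
      exact Finset.sum_comm
    rw [h2]
    simp only [h1, hΛ.column_weight]
    simp only [Finset.sum_const, Finset.card_univ, Fintype.card_fin, smul_eq_mul]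
    linarith
  have heq := (Finset.sum_eq_sum_iff_of_le fun i _ => Finset.card_le_card (hsub i)).1 hsum
  have hIeq : ∀ i, I i = Finset.univ.filter fun l => Λ i l = true := fun i =>
    Finset.eq_of_subset_of_card_le (hsub i) (heq i (Finset.mem_univ i)).ge
  intro l
  rw [← hΛ.column_weight l]
  congr 1
  ext i
  simp [hIeq]

theorem card_matrix_fin {F : Type*} [Fintype F] {k β : ℕ} :
    Fintype.card (Matrix (Fin β) (Fin k) F) = Fintype.card F ^ (β * k) := by
  rw [mul_comm, pow_mul]
  exact (Fintype.card_congr (Equiv.refl (Fin β → Fin k → F))).trans (by simp)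

/-! ### Entropies of the responses -/

open UniformEntropy

/-- The first `j` entries of a tuple, the others being replaced by zero. -/
def firstEntries {M : Type*} [Zero M] {f : ℕ} (j : ℕ) (c : Fin f → M) : Fin f → M :=
  fun m => if m.val < j then c m else 0

theorem firstEntries_eq_iff {M : Type*} [Zero M] {f j : ℕ} {c c' : Fin f → M} :
    firstEntries j c = firstEntries j c' ↔ ∀ m : Fin f, m.val < j → c m = c' m := by
  unfold firstEntries
  rw [funext_iff]
  refine forall_congr' fun m => ?_
  by_cases h : m.val < j <;> simp [h]

theorem fiberCard_firstEntries_succ {M : Type*} [Zero M] [Fintype M] {f j : ℕ} (hj : j < f)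
    (c : Fin f → M) :
    fiberCard (firstEntries j) (firstEntries j c) =
      Fintype.card M * fiberCard (firstEntries (j + 1)) (firstEntries (j + 1) c) := by
  have h : ∀ j, fiberCard (firstEntries j) (firstEntries j c) =
      ∏ m : Fin f, fiberCard (fun x : M => if m.val < j then x else 0)
        (if m.val < j then c m else 0) := fun j =>
    fiberCard_pi (fun (m : Fin f) (x : M) => if m.val < j then x else 0)
      (fun m => if m.val < j then c m else 0)
  rw [h, h, ← Finset.mul_prod_erase Finset.univ _ (Finset.mem_univ (⟨j, hj⟩ : Fin f)),
    ← Finset.mul_prod_erase Finset.univ _ (Finset.mem_univ (⟨j, hj⟩ : Fin f)), ← mul_assoc]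
  congr 1
  · have h1 : fiberCard (fun x : M => if j < j + 1 then x else 0)
        (if j < j + 1 then c ⟨j, hj⟩ else 0) = 1 :=
      Finset.card_eq_one.2 ⟨c ⟨j, hj⟩, by ext; simp⟩
    rw [h1, mul_one]
    simp [fiberCard, Finset.card_univ]
  · refine Finset.prod_congr rfl fun m hm => ?_
    have hne : m.val ≠ j := fun h => (Finset.mem_erase.1 hm).1 (Fin.ext h)
    have : m.val < j ↔ m.val < j + 1 := by omega
    simp [this]

section InformationSets

variable {F : Type*} [Field F] [Fintype F] {k n f β : ℕ}

/-- The contents of the nodes of an information set are in bijection with the files. -/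
theorem IsInformationSet.bijective_nodeContent {G : Matrix (Fin k) (Fin n) F}
    {I : Finset (Fin n)} (hI : IsInformationSet G I) :
    Function.Bijective fun (X : Fin f → Matrix (Fin β) (Fin k) F) (l : I) =>
      nodeContent G X l.val := by
  classical
  refine (Fintype.bijective_iff_injective_and_card _).2 ⟨fun X X' h => ?_, ?_⟩
  · funext m
    refine hI.eq_of_columns_eq fun l hl r => ?_
    exact congrFun (congrFun (congrFun h ⟨l, hl⟩) m) r
  · have hM : Fintype.card (Matrix (Fin β) (Fin k) F) = (Fintype.card F ^ k) ^ β := by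
      rw [card_matrix_fin, mul_comm, pow_mul]
    rw [Fintype.card_fun, Fintype.card_fun, Fintype.card_fun, Fintype.card_fun, hM,
      Fintype.card_coe, hI.1, Fintype.card_fin, Fintype.card_fin]
    simp only [← pow_mul]
    congr 1
    ring

theorem IsInformationSet.firstEntries_eq_iff {F : Type*} [Field F] {G : Matrix (Fin k) (Fin n) F}
    {I : Finset (Fin n)} (hI : IsInformationSet G I) {j : ℕ}
    (X X' : Fin f → Matrix (Fin β) (Fin k) F) :
    firstEntries j X = firstEntries j X' ↔
      (fun l : I => firstEntries j (nodeContent G X l.val)) =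
        fun l : I => firstEntries j (nodeContent G X' l.val) := by
  rw [_root_.firstEntries_eq_iff, funext_iff]
  simp only [_root_.firstEntries_eq_iff]
  constructor
  · intro h l m hm
    unfold nodeContent
    rw [h m hm]
  · intro h m hm
    refine hI.eq_of_columns_eq fun l hl r => ?_
    exact congrFun (h ⟨l, hl⟩ m hm) r

/-- Given some of the files, the responses of the nodes of an information set are independent. -/
theorem IsInformationSet.condEnt_responses {S : Type*} {G : Matrix (Fin k) (Fin n) F}
    {I : Finset (Fin n)} (hI : IsInformationSet G I) (j : ℕ)
    (g : I → (Fin f → Fin β → F) → S) :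
    condEnt (fun (X : Fin f → Matrix (Fin β) (Fin k) F) (l : I) => g l (nodeContent G X l.val))
        (firstEntries j) = ∑ l, condEnt (g l) (firstEntries j) := by
  classical
  rw [← condEnt_pi g fun _ => firstEntries j,
    ← condEnt_comp_equiv (Equiv.ofBijective _ (hI.bijective_nodeContent (f := f) (β := β)))]
  exact condEnt_congr (fun _ _ => Iff.rfl) hI.firstEntries_eq_iff

/-- Passes from the space of files to the space of contents of one node; it is the independence
statement with all other responses masked by a constant. -/
theorem IsInformationSet.condEnt_response {S : Type*} {G : Matrix (Fin k) (Fin n) F}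
    {I : Finset (Fin n)} (hI : IsInformationSet G I) {l : Fin n} (hl : l ∈ I) (j : ℕ)
    (g : (Fin f → Fin β → F) → S) :
    condEnt (fun X : Fin f → Matrix (Fin β) (Fin k) F => g (nodeContent G X l))
        (firstEntries j) = condEnt g (firstEntries j) := by
  classical
  have h := hI.condEnt_responses (β := β) j
    fun (i : I) c => if i = ⟨l, hl⟩ then some (g c) else none
  rw [Finset.sum_eq_single (⟨l, hl⟩ : I)] at h
  · refine (condEnt_congr (fun X X' => ?_) fun _ _ => Iff.rfl).trans
      (h.trans (condEnt_congr (fun X X' => ?_) fun _ _ => Iff.rfl))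
    · rw [funext_iff]
      constructor
      · intro h i
        by_cases hi : i = ⟨l, hl⟩
        · subst hi
          simp [h]
        · simp [hi]
      · intro h
        simpa using h ⟨l, hl⟩
    · simp
  · intro i _ hi
    simp only [hi, if_false]
    exact condEnt_const _ _
  · simp

/-- If `Y` determines the next file, revealing that file lowers the conditional entropy of `Y` by
the entropy of one file. -/
theorem condEnt_eq_add_of_determines {S M : Type*} [Zero M] [Fintype M] {j : ℕ} (hj : j < f)
    (Y : (Fin f → M) → S) (hY : ∀ X X', Y X = Y X' → X ⟨j, hj⟩ = X' ⟨j, hj⟩) :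
    condEnt Y (firstEntries j) = Real.log (Fintype.card M) + condEnt Y (firstEntries (j + 1)) := by
  have hM : (Fintype.card M : ℝ) ≠ 0 := by
    have : Nonempty M := ⟨0⟩
    exact_mod_cast Fintype.card_ne_zero
  have hcard : (Fintype.card (Fin f → M) : ℝ) ≠ 0 := by
    have : Nonempty M := ⟨0⟩
    exact_mod_cast Fintype.card_ne_zero
  unfold condEnt
  rw [← mul_div_cancel_right₀ (Real.log (Fintype.card M)) hcard, ← add_div]
  congr 1
  rw [mul_comm, ← nsmul_eq_mul, ← Finset.card_univ, ← Finset.sum_const, ← Finset.sum_add_distrib]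
  refine Finset.sum_congr rfl fun X _ => ?_
  rw [fiberCard_firstEntries_succ hj, Nat.cast_mul, Real.log_mul hM
    (by exact_mod_cast (fiberCard_pos _ X).ne'), add_sub_assoc]
  congr 3
  -- Since `Y` fixes file `j`, the joint fibres agree; only the conditioning fibre shrinks, by the
  -- factor `|M|`.
  refine congrArg Nat.cast (fiberCard_congr (Z := fun X => (firstEntries j X, Y X))
    (Z' := fun X => (firstEntries (j + 1) X, Y X)) fun X' => ?_)
  simp only [Prod.mk.injEq, firstEntries_eq_iff]
  constructor
  · rintro ⟨h1, h2⟩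
    refine ⟨fun m hm => ?_, h2⟩
    rcases Nat.lt_succ_iff_lt_or_eq.1 hm with h | h
    · exact h1 m h
    · rw [show m = ⟨j, hj⟩ from Fin.ext h]
      exact hY _ _ h2
  · rintro ⟨h1, h2⟩
    exact ⟨fun m hm => h1 m (by omega), h2⟩

/-- One step of the converse, for fixed queries. -/
theorem sum_condEnt_response_ge {S : Type*} {G : Matrix (Fin k) (Fin n) F} {κ ν : ℕ} (hκ : 0 < κ)
    {I : Fin ν → Finset (Fin n)} (hI : ∀ i, IsInformationSet G (I i))
    (hw : ∀ l, (Finset.univ.filter fun i => l ∈ I i).card = κ) {j : ℕ} (hj : j < f)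
    (g : Fin n → (Fin f → Fin β → F) → S)
    (hg : ∀ X X' : Fin f → Matrix (Fin β) (Fin k) F,
      (∀ l, g l (nodeContent G X l) = g l (nodeContent G X' l)) → X ⟨j, hj⟩ = X' ⟨j, hj⟩) :
    ν * ((β * k : ℕ) * Real.log (Fintype.card F)) +
        κ * ∑ l, condEnt (g l) (firstEntries (j + 1)) ≤
      ν * ∑ l, condEnt (g l) (firstEntries j) := by
  classical
  set Y : (Fin f → Matrix (Fin β) (Fin k) F) → Fin n → S := fun X l => g l (nodeContent G X l)
    with hYdef
  have h1 : condEnt Y (firstEntries j) ≤ ∑ l, condEnt (g l) (firstEntries j) := by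
    refine (condEnt_pi_le (fun l X => g l (nodeContent G X l)) (firstEntries j)).trans_eq ?_
    refine Finset.sum_congr rfl fun l _ => ?_
    -- Positivity of `κ` places every node in some information set.
    obtain ⟨i, hi⟩ := Finset.card_pos.1 ((hw l).symm ▸ hκ)
    exact (hI i).condEnt_response (Finset.mem_filter.1 hi).2 j (g l)
  rw [condEnt_eq_add_of_determines hj Y fun X X' h => hg X X' fun l => congrFun h l, card_matrix_fin,
    Nat.cast_pow, Real.log_pow] at h1
  have h2 : ∀ i, ∑ l ∈ I i, condEnt (g l) (firstEntries (j + 1)) ≤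
      condEnt Y (firstEntries (j + 1)) := fun i => by
    rw [← Finset.sum_coe_sort (I i), ← (hI i).condEnt_responses (j + 1) fun l => g l.val]
    exact condEnt_mono fun X X' h => funext fun l => congrFun h l.val
  have h3 : ∑ i, ∑ l ∈ I i, condEnt (g l) (firstEntries (j + 1)) =
      κ * ∑ l, condEnt (g l) (firstEntries (j + 1)) := by
    have h : ∀ i, ∑ l ∈ I i, condEnt (g l) (firstEntries (j + 1)) =
        ∑ l, if l ∈ I i then condEnt (g l) (firstEntries (j + 1)) else 0 := fun i => by
      rw [Finset.sum_ite_mem, Finset.univ_inter]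
    simp only [h]
    rw [Finset.sum_comm, Finset.mul_sum]
    refine Finset.sum_congr rfl fun l _ => ?_
    rw [← Finset.sum_filter, Finset.sum_const, hw, nsmul_eq_mul]
  have h4 : κ * ∑ l, condEnt (g l) (firstEntries (j + 1)) ≤
      ν * condEnt Y (firstEntries (j + 1)) := by
    rw [← h3]
    refine (Finset.sum_le_sum fun i _ => h2 i).trans_eq ?_
    simp
  have h5 := mul_le_mul_of_nonneg_left h1 (Nat.cast_nonneg (α := ℝ) ν)
  rw [mul_add] at h5
  linarith

theorem condEnt_le_of_length_eq (g : (Fin f → Fin β → F) → List F) {d : ℕ}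
    (hg : ∀ c, (g c).length = d) (j : ℕ) :
    condEnt g (firstEntries j) ≤ d * Real.log (Fintype.card F) := by
  rw [← Real.log_pow, ← Nat.cast_pow]
  refine le_trans (condEnt_mono (Y := fun c => show List.Vector F d from ⟨g c, hg c⟩)
    fun c c' h => congrArg Subtype.val h) ?_
  refine (condEnt_le_log_card _ _).trans_eq ?_
  rw [card_vector]

end InformationSets

/-! ### The converse, averaged over queries. -/

theorem PMF.tsum_map_mul {α β : Type*} (p : PMF α) (g : α → β) (φ : β → ℝ≥0∞) :
    ∑' b, p.map g b * φ b = ∑' a, p a * φ (g a) := by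
  classical
  simp only [PMF.map_apply, ← ENNReal.tsum_mul_right]
  rw [ENNReal.tsum_comm]
  refine tsum_congr fun a => ?_
  rw [tsum_eq_single (g a)]
  · simp
  · intro b hb
    simp [hb]

theorem mdsPIRCapacity_eq {n k : ℕ} (hkn : k < n) (f : ℕ) :
    mdsPIRCapacity n k f = (∑ i ∈ Finset.range f, ((k : ℝ) / n) ^ i)⁻¹ := by
  have hn : (0 : ℝ) < n := by exact_mod_cast (Nat.zero_le k).trans_lt hkn
  have hx : (k : ℝ) / n ≠ 1 := by
    rw [Ne, div_eq_one_iff_eq hn.ne']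
    exact_mod_cast hkn.ne
  rw [geom_sum_eq hx, mdsPIRCapacity, inv_div, sub_div, div_self hn.ne', ← neg_div_neg_eq (_ - 1), neg_sub,
    neg_sub]
  exact (div_eq_mul_inv _ _).symm

theorem ofReal_mdsPIRCapacity {n k f : ℕ} (hkn : k < n) (hf : 0 < f) :
    ENNReal.ofReal (mdsPIRCapacity n k f) =
      (∑ i ∈ Finset.range f, ((k : ℝ≥0∞) / n) ^ i)⁻¹ := by
  have hn : (0 : ℝ) < n := by exact_mod_cast (Nat.zero_le k).trans_lt hkn
  have hpos : 0 < ∑ i ∈ Finset.range f, ((k : ℝ) / n) ^ i := by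
    refine Finset.sum_pos' (fun i _ => by positivity) ⟨0, by simpa using hf, by simp⟩
  rw [mdsPIRCapacity_eq hkn, ENNReal.ofReal_inv_of_pos hpos,
    ENNReal.ofReal_sum_of_nonneg fun i _ => by positivity]
  congr 1
  refine Finset.sum_congr rfl fun i _ => ?_
  rw [ENNReal.ofReal_pow (by positivity), ENNReal.ofReal_div_of_pos hn, ENNReal.ofReal_natCast,
    ENNReal.ofReal_natCast]

namespace PIRProtocol

variable {F : Type*} [Field F] [Fintype F] {k n f : ℕ}

/-- The sum over the nodes of the conditional entropy of the response, given the query to the node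
and the first `j` files, when file `m` is wanted. -/
def respEntropy (P : PIRProtocol F n f) (m : Fin f) (j : ℕ) : ℝ≥0∞ :=
  ∑' q, P.queryLaw m q * ∑ l, ENNReal.ofReal (condEnt (P.resp l (q l)) (firstEntries j))

/-- A sum over nodes sees only the marginal query laws, which privacy fixes. The joint entropy of
the responses has no such invariance. -/
theorem respEntropy_eq_of_isPrivate {P : PIRProtocol F n f} {G : Matrix (Fin k) (Fin n) F}
    (hP : P.IsPrivate G) (m m' : Fin f) (j : ℕ) : P.respEntropy m j = P.respEntropy m' j := by
  have h : ∀ m, P.respEntropy m j = ∑ l, ∑' ql, P.nodeQueryLaw m l ql *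
      ENNReal.ofReal (condEnt (P.resp l ql) (firstEntries j)) := fun m => by
    unfold respEntropy nodeQueryLaw
    simp only [PMF.tsum_map_mul, Finset.mul_sum]
    rw [Summable.tsum_finsetSum fun _ _ => ENNReal.summable]
  rw [h, h]
  simp only [(isPrivate_iff P G).1 hP _ m m']

theorem respEntropy_zero_le (P : PIRProtocol F n f) (m : Fin f) :
    P.respEntropy m 0 ≤ ENNReal.ofReal (Real.log (Fintype.card F)) * P.downloadOf m := by
  unfold respEntropy downloadOf
  rw [← ENNReal.tsum_mul_left]
  refine ENNReal.tsum_le_tsum fun q => ?_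
  rw [mul_left_comm]
  gcongr
  rw [Finset.mul_sum]
  refine Finset.sum_le_sum fun l _ => ?_
  refine (ENNReal.ofReal_le_ofReal
    (condEnt_le_of_length_eq _ (fun c => P.resp_length l (q l) c) 0)).trans_eq ?_
  rw [ENNReal.ofReal_mul (Nat.cast_nonneg _), ENNReal.ofReal_natCast, mul_comm]

theorem respEntropy_succ_le {P : PIRProtocol F n f} {G : Matrix (Fin k) (Fin n) F}
    (hP : P.Recovers G) {κ ν : ℕ} (hκ : 0 < κ) {I : Fin ν → Finset (Fin n)}
    (hI : ∀ i, IsInformationSet G (I i))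
    (hw : ∀ l, (Finset.univ.filter fun i => l ∈ I i).card = κ) {j : ℕ} (hj : j < f) :
    (ν : ℝ≥0∞) * ((P.β * k : ℕ) * ENNReal.ofReal (Real.log (Fintype.card F))) +
        κ * P.respEntropy ⟨j, hj⟩ (j + 1) ≤ ν * P.respEntropy ⟨j, hj⟩ j := by
  set L : ℝ≥0∞ := (ν : ℝ≥0∞) * ((P.β * k : ℕ) * ENNReal.ofReal (Real.log (Fintype.card F)))
    with hL
  have h1 : L = ∑' q, P.queryLaw ⟨j, hj⟩ q * L := by
    rw [ENNReal.tsum_mul_right, PMF.tsum_coe, one_mul]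
  rw [h1]
  unfold respEntropy
  rw [← ENNReal.tsum_mul_left, ← ENNReal.tsum_mul_left, ← ENNReal.tsum_add]
  refine ENNReal.tsum_le_tsum fun q => ?_
  rw [mul_left_comm (κ : ℝ≥0∞), ← mul_add, mul_left_comm (ν : ℝ≥0∞)]
  by_cases hq : P.queryLaw ⟨j, hj⟩ q = 0
  · simp [hq]
  gcongr
  have h2 := ENNReal.ofReal_le_ofReal (sum_condEnt_response_ge (G := G) hκ hI hw hj
    (fun l => P.resp l (q l)) ((recovers_iff P G).1 hP _ q hq))
  have hs : ∀ j, ENNReal.ofReal (∑ l, condEnt (P.resp l (q l)) (firstEntries j)) =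
      ∑ l, ENNReal.ofReal (condEnt (P.resp l (q l)) (firstEntries j)) := fun j =>
    ENNReal.ofReal_sum_of_nonneg fun l _ => condEnt_nonneg _ _
  have hlog : 0 ≤ Real.log (Fintype.card F) := Real.log_natCast_nonneg _
  rw [ENNReal.ofReal_add (by positivity)
    (mul_nonneg (Nat.cast_nonneg _) (Finset.sum_nonneg fun l _ => condEnt_nonneg _ _)),
    ENNReal.ofReal_mul (Nat.cast_nonneg _), ENNReal.ofReal_mul (Nat.cast_nonneg _),
    ENNReal.ofReal_mul (Nat.cast_nonneg _), ENNReal.ofReal_mul (Nat.cast_nonneg _), hs, hs] at h2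
  simpa only [ENNReal.ofReal_natCast, hL] using h2

/-- The converse: no perfect PIR protocol has a rate above the MDS-PIR capacity. -/
theorem rate_le (hk : 0 < k) (hkn : k < n) (hf : 0 < f) {G : Matrix (Fin k) (Fin n) F}
    (hC : IsMDSPIRCapacityAchieving G) {P : PIRProtocol F n f} (hP : P.IsPerfectPIR G) :
    P.rate k ≤ ENNReal.ofReal (mdsPIRCapacity n k f) := by
  obtain ⟨κ, ν, hν, hκν, I, hI, hw⟩ := hC.exists_informationSets (hk.trans hkn)
  have hκ : 0 < κ := Nat.pos_of_ne_zero fun h => by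
    rw [h, zero_mul] at hκν
    exact (Nat.mul_pos hk hν).ne hκν
  have hn : 0 < n := hk.trans hkn
  set m₀ : Fin f := ⟨0, hf⟩
  set lF : ℝ≥0∞ := ENNReal.ofReal (Real.log (Fintype.card F)) with hlF
  have hlF0 : lF ≠ 0 := by
    rw [hlF, Ne, ENNReal.ofReal_eq_zero, not_le]
    exact Real.log_pos (by exact_mod_cast Fintype.one_lt_card)
  have hlFtop : lF ≠ ∞ := ENNReal.ofReal_ne_top
  set L : ℝ≥0∞ := ((P.β * k : ℕ) : ℝ≥0∞) with hL
  have hν0 : (ν : ℝ≥0∞) ≠ 0 := by exact_mod_cast hν.ne'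
  have hνtop : (ν : ℝ≥0∞) ≠ ∞ := ENNReal.natCast_ne_top ν
  have hn0 : (n : ℝ≥0∞) ≠ 0 := by exact_mod_cast hn.ne'
  have hntop : (n : ℝ≥0∞) ≠ ∞ := ENNReal.natCast_ne_top n
  have hr : (κ : ℝ≥0∞) = ν * ((k : ℝ≥0∞) / n) := by
    rw [← mul_div_assoc, ENNReal.eq_div_iff hn0 hntop]
    exact_mod_cast (by linarith : n * κ = ν * k)
  have hstep : ∀ j, j < f → L * lF + (k : ℝ≥0∞) / n * P.respEntropy m₀ (j + 1) ≤
      P.respEntropy m₀ j := fun j hj => by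
    have h := respEntropy_succ_le hP.2 hκ hI hw hj
    -- The inequality was obtained with file `j` wanted; moving both terms to `m₀` makes consecutive
    -- steps composable.
    rw [respEntropy_eq_of_isPrivate hP.1 _ m₀ j, respEntropy_eq_of_isPrivate hP.1 _ m₀ (j + 1),
      hr, mul_assoc, ← mul_add] at h
    exact (ENNReal.mul_le_mul_iff_right hν0 hνtop).1 h
  have hiter : ∀ j, j ≤ f → (∑ i ∈ Finset.range j, ((k : ℝ≥0∞) / n) ^ i) * (L * lF) +
      ((k : ℝ≥0∞) / n) ^ j * P.respEntropy m₀ j ≤ P.respEntropy m₀ 0 := by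
    intro j
    induction j with
    | zero => simp
    | succ j ih =>
      intro hj
      refine le_trans ?_ (ih (by omega))
      rw [Finset.sum_range_succ, add_mul, add_assoc, pow_succ, mul_assoc, ← mul_add]
      gcongr
      exact hstep j (by omega)
  set s := ∑ i ∈ Finset.range f, ((k : ℝ≥0∞) / n) ^ i with hs
  have hD : s * L ≤ P.download := by
    have h1 : s * (L * lF) ≤ lF * P.download :=
      (le_self_add.trans (hiter f le_rfl)).trans ((P.respEntropy_zero_le m₀).trans
        (mul_le_mul_right (le_iSup P.downloadOf m₀) _))
    rw [← mul_assoc, mul_comm _ lF] at h1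
    exact (ENNReal.mul_le_mul_iff_right hlF0 hlFtop).1 h1
  have hL0 : L ≠ 0 := by
    rw [hL]
    exact_mod_cast (Nat.mul_pos P.β_pos hk).ne'
  have hs0 : s ≠ 0 := by
    intro h
    have := Finset.sum_eq_zero_iff.1 h 0 (by simpa using hf)
    simp at this
  rw [ofReal_mdsPIRCapacity hkn hf, rate, ← hs]
  refine (ENNReal.div_le_div_left hD _).trans_eq ?_
  rw [mul_comm s L, ENNReal.div_eq_inv_mul, ENNReal.mul_inv (Or.inl hL0)
    (Or.inl (ENNReal.natCast_ne_top _)), mul_right_comm,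
    ENNReal.inv_mul_cancel hL0 (ENNReal.natCast_ne_top _), one_mul]

end PIRProtocol

theorem PMF.map_uniformOfFintype_equiv {α : Type*} [Fintype α] [Nonempty α] (e : α ≃ α) :
    (PMF.uniformOfFintype α).map e = PMF.uniformOfFintype α := by
  classical
  ext b
  rw [PMF.map_apply, tsum_eq_single (e.symm b)]
  · simp
  · intro a ha
    have : b ≠ e a := fun h => ha (by simp [h])
    simp [this]

/-! ### A capacity-achieving protocol -/

/-- The labels of the stripes into which each file is cut. -/
abbrev StripeLabel (κ ν f : ℕ) : Type := Fin (ν - κ) × (Fin f → Fin ν)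

namespace StripeLabel

variable {κ ν f : ℕ}

/-- The relabelling of the stripes that applies a permutation to the `m`-th coordinate. -/
def permCoord (m : Fin f) (σ : Equiv.Perm (Fin ν)) : Equiv.Perm (StripeLabel κ ν f) where
  toFun s := (s.1, Function.update s.2 m (σ (s.2 m)))
  invFun s := (s.1, Function.update s.2 m (σ.symm (s.2 m)))
  left_inv s := by simp
  right_inv s := by simp

/-- The label of the stripe of file `j` that enters the response symbol with index `(q, e)`. -/
def ofIndex (hκν : κ ≤ ν) (q : Fin f → Fin ν) (e : Fin κ) (j : Fin f) (h : κ ≤ q j) :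
    StripeLabel κ ν f :=
  (⟨q j - κ, Nat.sub_lt_sub_right h (q j).2⟩, Function.update q j (Fin.castLE hκν e))

/-- Alignment: for an unwanted file the twist of the index and that of the label cancel, so the
stripe used does not depend on `σ`, hence not on the node. -/
theorem permCoord_ofIndex_of_ne (hκν : κ ≤ ν) {m j : Fin f} (hj : j ≠ m)
    (σ : Equiv.Perm (Fin ν)) (a : Fin f → Fin ν) (e : Fin κ)
    (h : κ ≤ (Function.update a m (σ (a m)) j : Fin ν)) (h' : κ ≤ a j) :
    permCoord m σ.symm (ofIndex hκν (Function.update a m (σ (a m))) e j h) =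
      ofIndex hκν a e j h' := by
  unfold permCoord ofIndex
  refine Prod.ext (Fin.ext ?_) ?_
  · simp [hj]
  · funext i
    by_cases him : i = m
    · subst him
      simp [hj.symm]
    · by_cases hij : i = j
      · subst hij
        simp [him]
      · simp [him, hij]

theorem permCoord_ofIndex_self (hκν : κ ≤ ν) (m : Fin f)
    (σ : Equiv.Perm (Fin ν)) (s : StripeLabel κ ν f) (e : Fin κ) (q : Fin f → Fin ν)
    (hq : q = Function.update s.2 m (q m)) (hqm : (q m : ℕ) = s.1 + κ)
    (he : (σ (s.2 m) : ℕ) = e) (h : κ ≤ q m) :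
    permCoord m σ.symm (ofIndex hκν q e m h) = s := by
  have he' : Fin.castLE hκν e = σ (s.2 m) := Fin.ext he.symm
  unfold permCoord ofIndex
  refine Prod.ext (Fin.ext ?_) ?_
  · simp [hqm]
  · have hidem : Function.update (Function.update q m (Fin.castLE hκν e)) m
        (σ.symm (Function.update q m (Fin.castLE hκν e) m)) = s.2 := by
      rw [Function.update_idem, Function.update_self, he', Equiv.symm_apply_apply]
      funext i
      by_cases hi : i = m
      · subst hi
        simp
      · rw [Function.update_of_ne hi, hq, Function.update_of_ne hi]
    exact hidem

end StripeLabel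

/-! ### Response symbols and their decoding. -/

section Answer

variable {F : Type*} [Field F] {k n f β κ ν : ℕ}

/-- The response symbol with index `p = (q, e)`: the sum of the stored symbols of one stripe of
each file `j` with `κ ≤ q j`. -/
def stripeAnswer (hκν : κ ≤ ν) (θ : Fin f → StripeLabel κ ν f ≃ Fin β) (c : Fin f → Fin β → F)
    (p : (Fin f → Fin ν) × Fin κ) : F :=
  ∑ j, if h : κ ≤ p.1 j then c j (θ j (StripeLabel.ofIndex hκν p.1 p.2 j h)) else 0

theorem stripeAnswer_sub (hκν : κ ≤ ν) (θ : Fin f → StripeLabel κ ν f ≃ Fin β)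
    (c c' : Fin f → Fin β → F) (p : (Fin f → Fin ν) × Fin κ) :
    stripeAnswer hκν θ (c - c') p = stripeAnswer hκν θ c p - stripeAnswer hκν θ c' p := by
  unfold stripeAnswer
  rw [← Finset.sum_sub_distrib]
  refine Finset.sum_congr rfl fun j _ => ?_
  split_ifs <;> simp

theorem stripeAnswer_of_forall_lt (hκν : κ ≤ ν) (θ : Fin f → StripeLabel κ ν f ≃ Fin β)
    (c : Fin f → Fin β → F) {p : (Fin f → Fin ν) × Fin κ} (hp : ¬ ∃ j, κ ≤ p.1 j) :
    stripeAnswer hκν θ c p = 0 := by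
  refine Finset.sum_eq_zero fun j _ => dif_neg fun h => hp ⟨j, h⟩

theorem nodeContent_sub (G : Matrix (Fin k) (Fin n) F) (X X' : Fin f → Matrix (Fin β) (Fin k) F)
    (l : Fin n) : nodeContent G (X - X') l = nodeContent G X l - nodeContent G X' l := by
  funext m i
  simp [nodeContent, Matrix.sub_mul]

/-- The combination of stripes of the files other than `m` that interferes with the wanted
stripes. -/
def interference (hκν : κ ≤ ν) (π : Fin f → StripeLabel κ ν f ≃ Fin β) (m : Fin f)
    (D : Fin f → Matrix (Fin β) (Fin k) F) (a : Fin f → Fin ν) (e : Fin κ) :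
    Matrix (Fin 1) (Fin k) F :=
  ∑ j, if h : j ≠ m ∧ κ ≤ a j then
    Matrix.of fun _ => D j (π j (StripeLabel.ofIndex hκν a e j h.2)) else 0

theorem interference_mul (hκν : κ ≤ ν) (π : Fin f → StripeLabel κ ν f ≃ Fin β) (m : Fin f)
    (D : Fin f → Matrix (Fin β) (Fin k) F) (a : Fin f → Fin ν) (e : Fin κ)
    (G : Matrix (Fin k) (Fin n) F) (l : Fin n) :
    (interference hκν π m D a e * G) 0 l = ∑ j, if h : j ≠ m ∧ κ ≤ a j then
      (D j * G) (π j (StripeLabel.ofIndex hκν a e j h.2)) l else 0 := by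
  unfold interference
  rw [Matrix.sum_mul, Matrix.sum_apply]
  refine Finset.sum_congr rfl fun j _ => ?_
  split_ifs
  · simp [Matrix.mul_apply]
  · simp

theorem stripeAnswer_permCoord (hκν : κ ≤ ν) (π : Fin f → StripeLabel κ ν f ≃ Fin β) (m : Fin f)
    (D : Fin f → Matrix (Fin β) (Fin k) F) (a : Fin f → Fin ν) (e : Fin κ)
    (G : Matrix (Fin k) (Fin n) F) (l : Fin n) (σ : Equiv.Perm (Fin ν)) :
    stripeAnswer hκν (fun j => (StripeLabel.permCoord m σ.symm).trans (π j)) (nodeContent G D l)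
        (Function.update a m (σ (a m)), e) =
      (if h : κ ≤ (Function.update a m (σ (a m)) m : Fin ν) then
        (D m * G) (π m (StripeLabel.permCoord m σ.symm
          (StripeLabel.ofIndex hκν (Function.update a m (σ (a m))) e m h))) l else 0) +
        (interference hκν π m D a e * G) 0 l := by
  rw [interference_mul, stripeAnswer, ← Finset.add_sum_erase _ _ (Finset.mem_univ m),
    ← Finset.add_sum_erase (Finset.univ) (fun j => dite (j ≠ m ∧ κ ≤ a j) _ _)
      (Finset.mem_univ m)]
  congr 1
  rw [dif_neg (by simp), zero_add]
  refine Finset.sum_congr rfl fun j hj => ?_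
  have hne := (Finset.mem_erase.1 hj).1
  have hiff : κ ≤ (Function.update a m (σ (a m)) j : Fin ν) ↔ j ≠ m ∧ κ ≤ a j := by
    simp [hne]
  by_cases h : j ≠ m ∧ κ ≤ a j
  · rw [dif_pos (hiff.2 h), dif_pos h]
    unfold nodeContent
    rw [Equiv.trans_apply, StripeLabel.permCoord_ofIndex_of_ne hκν hne σ a e _ h.2]
  · rw [dif_neg (fun h' => h (hiff.1 h')), dif_neg h]

/-- Recovery in linear form, for the difference `D` of two file systems giving the same responses.
-/
theorem eq_zero_of_stripeAnswer_eq_zero (hκν : κ ≤ ν) {G : Matrix (Fin k) (Fin n) F}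
    {I : Fin ν → Finset (Fin n)} (hI : ∀ i, IsInformationSet G (I i))
    {τ : Fin n → Equiv.Perm (Fin ν)} (hτ : ∀ l i, l ∈ I i ↔ (τ l i : ℕ) < κ)
    (π : Fin f → StripeLabel κ ν f ≃ Fin β) (m : Fin f) (D : Fin f → Matrix (Fin β) (Fin k) F)
    (h : ∀ l p, stripeAnswer hκν (fun j => (StripeLabel.permCoord m (τ l).symm).trans (π j))
      (nodeContent G D l) p = 0) : D m = 0 := by
  -- At a node of `I (a m)` the twisted coordinate is below `κ`, so file `m` is absent and the
  -- symbol is pure interference. These nodes determine the interference codeword.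
  have hint : ∀ a e, interference hκν π m D a e = 0 := fun a e => by
    refine (hI (a m)).eq_of_columns_eq fun l hl r => ?_
    have hlt := (hτ l (a m)).1 hl
    have h1 := stripeAnswer_permCoord hκν π m D a e G l (τ l)
    rw [h, dif_neg (by simpa using hlt), zero_add] at h1
    rw [Subsingleton.elim r 0, ← h1]
    simp
  funext r
  obtain ⟨s, rfl⟩ := (π m).surjective r
  have hrow : (Matrix.of fun _ => D m (π m s) : Matrix (Fin 1) (Fin k) F) = 0 := by
    refine (hI (s.2 m)).eq_of_columns_eq fun l hl r => ?_
    have hlt := (hτ l (s.2 m)).1 hl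
    have hs : (s.1 : ℕ) + κ < ν := by have := s.1.2; omega
    -- The index is chosen so that node `l` combines stripe `s` of file `m` with interference
    -- already known to vanish; as `l` runs through `I (s.2 m)`, this determines the whole stripe.
    set a : Fin f → Fin ν := Function.update s.2 m ((τ l).symm ⟨s.1 + κ, hs⟩) with ha
    have h1 := stripeAnswer_permCoord hκν π m D a ⟨τ l (s.2 m), hlt⟩ G l (τ l)
    have hq : Function.update a m (τ l (a m)) m = ⟨s.1 + κ, hs⟩ := by simp [ha]
    rw [h, hint, dif_pos (by rw [hq]; simp), StripeLabel.permCoord_ofIndex_self hκν m (τ l) s _ _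
      (by simp [ha]) (by rw [hq]) rfl] at h1
    simp only [Matrix.zero_mul, Matrix.zero_apply, add_zero] at h1 ⊢
    rw [h1]
    simp [Matrix.mul_apply]
  exact congrFun hrow 0

end Answer

/-! ### The protocol: privacy, recovery and rate. -/

namespace PIRProtocol

variable {F : Type*} [Field F] {k n f κ ν : ℕ}

/-- The indices of the symbols of a response. -/
def stripeIndices (κ ν f : ℕ) : Finset ((Fin f → Fin ν) × Fin κ) :=
  Finset.univ.filter fun p => ∃ j, κ ≤ p.1 j

/-- The omitted indices are those with all `f` coordinates below `κ`, whose symbols are empty sums.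
-/
theorem card_stripeIndices (hκν : κ ≤ ν) (f : ℕ) :
    (stripeIndices κ ν f).card + κ ^ f * κ = ν ^ f * κ := by
  classical
  have h : (Finset.univ.filter fun p : (Fin f → Fin ν) × Fin κ => ¬ ∃ j, κ ≤ p.1 j) =
      (Fintype.piFinset fun _ : Fin f => Finset.univ.filter fun i : Fin ν => (i : ℕ) < κ) ×ˢ
        (Finset.univ : Finset (Fin κ)) := by
    ext p
    simp [Fintype.mem_piFinset]
  have hc : (Finset.univ.filter fun i : Fin ν => (i : ℕ) < κ).card = κ := by
    rw [Fin.card_filter_val_lt, min_eq_right hκν]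
  have h1 := Finset.card_filter_add_card_filter_not (s := Finset.univ)
    (fun p : (Fin f → Fin ν) × Fin κ => ∃ j, κ ≤ p.1 j)
  rw [h, Finset.card_product, Fintype.card_piFinset] at h1
  simpa [hc, stripeIndices] using h1

/-- Each node receives, for each file, a bijective labelling of the stripes, and returns all
the response symbols `stripeAnswer` that are not empty sums. -/
def stripeProtocol (F : Type*) [Field F] {n f κ ν : ℕ} (hκν : κ < ν)
    (τ : Fin n → Equiv.Perm (Fin ν)) : PIRProtocol F n f where
  β := Fintype.card (StripeLabel κ ν f)
  β_pos := by
    have : Nonempty (Fin (ν - κ)) := ⟨⟨0, by omega⟩⟩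
    have : Nonempty (Fin ν) := ⟨⟨0, by omega⟩⟩
    exact Fintype.card_pos
  Query _ := Fin f → StripeLabel κ ν f ≃ Fin (Fintype.card (StripeLabel κ ν f))
  queryLaw m :=
    have : Nonempty (Fin f → StripeLabel κ ν f ≃ Fin (Fintype.card (StripeLabel κ ν f))) :=
      ⟨fun _ => Fintype.equivFin _⟩
    -- One random `π` is shared by all nodes; only the twist by `τ l` in coordinate `m` differs
    -- between them.
    (PMF.uniformOfFintype
      (Fin f → StripeLabel κ ν f ≃ Fin (Fintype.card (StripeLabel κ ν f)))).map
        fun π l j => (StripeLabel.permCoord m (τ l).symm).trans (π j)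
  respLength _ _ := (stripeIndices κ ν f).card
  resp _ θ c := (stripeIndices κ ν f).toList.map (stripeAnswer hκν.le θ c)
  resp_length _ _ _ := by simp

theorem stripeProtocol_isPrivate [Fintype F] (hκν : κ < ν) (τ : Fin n → Equiv.Perm (Fin ν))
    (G : Matrix (Fin k) (Fin n) F) : (stripeProtocol F (f := f) hκν τ).IsPrivate G := by
  rw [isPrivate_iff]
  have : Nonempty (Fin f → StripeLabel κ ν f ≃ Fin (Fintype.card (StripeLabel κ ν f))) :=
    ⟨fun _ => Fintype.equivFin _⟩
  have h : ∀ l m, (stripeProtocol F (f := f) hκν τ).nodeQueryLaw m l = PMF.uniformOfFintype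
      (Fin f → StripeLabel κ ν f ≃ Fin (Fintype.card (StripeLabel κ ν f))) := fun l m => by
    unfold nodeQueryLaw stripeProtocol
    simp only
    rw [PMF.map_comp]
    -- For a fixed node the twist is a bijection of the set of labellings, so it preserves the
    -- uniform law.
    exact PMF.map_uniformOfFintype_equiv
      ((Equiv.refl (Fin f)).arrowCongr
        ((StripeLabel.permCoord m (τ l)).equivCongr (Equiv.refl _)))
  intro l m m'
  rw [h, h]

theorem stripeProtocol_recovers [Fintype F] (hκν : κ < ν) {G : Matrix (Fin k) (Fin n) F}
    {I : Fin ν → Finset (Fin n)} (hI : ∀ i, IsInformationSet G (I i))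
    {τ : Fin n → Equiv.Perm (Fin ν)} (hτ : ∀ l i, l ∈ I i ↔ (τ l i : ℕ) < κ) :
    (stripeProtocol F (f := f) hκν τ).Recovers G := by
  rw [recovers_iff]
  intro m q hq X X' hX
  change Fin f → Matrix (Fin (Fintype.card (StripeLabel κ ν f))) (Fin k) F at X X'
  obtain ⟨π, -, rfl⟩ := (PMF.mem_support_map_iff _ _ _).1 ((PMF.mem_support_iff _ _).2 hq)
  refine sub_eq_zero.1 (eq_zero_of_stripeAnswer_eq_zero hκν.le hI hτ π m (X - X') fun l p => ?_)
  by_cases hp : ∃ j, κ ≤ p.1 j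
  · rw [nodeContent_sub, stripeAnswer_sub, sub_eq_zero]
    exact List.map_inj_left.1 (hX l) p (Finset.mem_toList.2 (by simpa [stripeIndices] using hp))
  · exact stripeAnswer_of_forall_lt _ _ _ hp

theorem stripeProtocol_download (hf : 0 < f) (hκν : κ < ν) (τ : Fin n → Equiv.Perm (Fin ν)) :
    (stripeProtocol F (f := f) hκν τ).download = ((n * (stripeIndices κ ν f).card : ℕ) : ℝ≥0∞) := by
  have h : ∀ m, (stripeProtocol F (f := f) hκν τ).downloadOf m =
      ((n * (stripeIndices κ ν f).card : ℕ) : ℝ≥0∞) := fun m => by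
    unfold downloadOf
    have : ∀ q : ∀ l, (stripeProtocol F (f := f) hκν τ).Query l,
        ∑ l, ((stripeProtocol F (f := f) hκν τ).respLength l (q l) : ℝ≥0∞) =
        ((n * (stripeIndices κ ν f).card : ℕ) : ℝ≥0∞) := fun q => by
      simp [stripeProtocol]
    simp only [this]
    rw [ENNReal.tsum_mul_right, PMF.tsum_coe, one_mul]
  have : Nonempty (Fin f) := ⟨⟨0, hf⟩⟩
  unfold download
  simp only [h, ciSup_const]

/-- The rate is `(ν - κ) * ν ^ f * k / (n * κ * (ν ^ f - κ ^ f))`, and `κ * n = k * ν` turns it into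
the capacity. -/
theorem stripeProtocol_rate (hk : 0 < k) (hf : 0 < f) (hn : 0 < n) (hκν : κ < ν)
    (hmul : κ * n = k * ν) (τ : Fin n → Equiv.Perm (Fin ν)) :
    (stripeProtocol F (f := f) hκν τ).rate k = ENNReal.ofReal (mdsPIRCapacity n k f) := by
  have hν : 0 < ν := by omega
  have hκ : 0 < κ := Nat.pos_of_ne_zero fun h => by
    rw [h, zero_mul] at hmul
    exact (Nat.mul_pos hk hν).ne hmul
  have hcard := card_stripeIndices hκν.le f
  have hpow : κ ^ f < ν ^ f := Nat.pow_lt_pow_left hκν hf.ne'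
  have hc : 0 < (stripeIndices κ ν f).card := by
    have := Nat.mul_lt_mul_of_pos_right hpow hκ
    omega
  have hβ : (stripeProtocol F (n := n) (f := f) hκν τ).β = (ν - κ) * ν ^ f := by
    simp [stripeProtocol]
  unfold rate
  rw [stripeProtocol_download hf, hβ, ← ENNReal.ofReal_natCast, ← ENNReal.ofReal_natCast,
    ← ENNReal.ofReal_div_of_pos (by exact_mod_cast Nat.mul_pos hn hc)]
  congr 1
  have hnR : (0 : ℝ) < n := by exact_mod_cast hn
  have hνR : (0 : ℝ) < ν := by exact_mod_cast hν
  have hκR : (0 : ℝ) < κ := by exact_mod_cast hκ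
  have hpowR : (0 : ℝ) < (ν : ℝ) ^ f - (κ : ℝ) ^ f := sub_pos.2 (by exact_mod_cast hpow)
  have hcardR : ((stripeIndices κ ν f).card : ℝ) = ((ν : ℝ) ^ f - (κ : ℝ) ^ f) * κ := by
    rw [sub_mul, eq_sub_iff_add_eq]
    exact_mod_cast hcard
  have hkn : (k : ℝ) / n = κ / ν := by
    rw [div_eq_div_iff hnR.ne' hνR.ne']
    exact_mod_cast hmul.symm
  have hkR : (k : ℝ) = κ / ν * n := by rw [← hkn]; field_simp
  have hone : 1 - ((κ : ℝ) / ν) ^ f = ((ν : ℝ) ^ f - (κ : ℝ) ^ f) / (ν : ℝ) ^ f := by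
    rw [div_pow, sub_div, div_self (by positivity)]
  rw [mdsPIRCapacity, hkn, hone, Nat.cast_mul, Nat.cast_mul, Nat.cast_mul, hcardR,
    Nat.cast_sub hκν.le, Nat.cast_pow, hkR]
  field_simp

end PIRProtocol

theorem exists_perm_mem_iff_lt {ν n κ : ℕ} {I : Fin ν → Finset (Fin n)}
    (hw : ∀ l, (Finset.univ.filter fun i => l ∈ I i).card = κ) :
    ∃ τ : Fin n → Equiv.Perm (Fin ν), ∀ l i, l ∈ I i ↔ (τ l i : ℕ) < κ := by
  classical
  have he : ∀ l, Nonempty ({i // l ∈ I i} ≃ {i : Fin ν // (i : ℕ) < κ}) := fun l => by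
    have hle : κ ≤ ν := by
      rw [← hw l]
      exact (Finset.card_le_univ _).trans_eq (Fintype.card_fin ν)
    refine ⟨Fintype.equivOfCardEq ?_⟩
    rw [Fintype.card_subtype, Fintype.card_subtype, hw, Fin.card_filter_val_lt, min_eq_right hle]
  refine ⟨fun l => (he l).some.extendSubtype, fun l i => ⟨fun h => ?_, fun h => ?_⟩⟩
  · exact (he l).some.extendSubtype_mem i h
  · by_contra hi
    exact (he l).some.extendSubtype_not_mem i hi h

end

theorem theorem3 {F : Type*} [Field F] [Fintype F] {k n f : ℕ} (hk : 0 < k) (hkn : k < n)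
    (hf : 0 < f) (G : Matrix (Fin k) (Fin n) F) (hG : IsGeneratorMatrix G)
    (hC : IsMDSPIRCapacityAchieving G) :
    pirCapacity G f = ENNReal.ofReal (mdsPIRCapacity n k f) ∧
      ∃ P : PIRProtocol F n f, P.IsPerfectPIR G ∧ P.HasConstantLengths ∧
        P.rate k = ENNReal.ofReal (mdsPIRCapacity n k f) := by
  have hn : 0 < n := hk.trans hkn
  obtain ⟨κ, ν, hν, hmul, I, hI, hw⟩ := hC.exists_informationSets hn
  have hκν : κ < ν := by
    by_contra! h
    have h1 : ν * n ≤ κ * n := Nat.mul_le_mul_right n h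
    have h2 : k * ν < n * ν := Nat.mul_lt_mul_of_pos_right hkn hν
    rw [mul_comm n ν] at h2
    omega
  obtain ⟨τ, hτ⟩ := exists_perm_mem_iff_lt hw
  have hP : (PIRProtocol.stripeProtocol F (f := f) hκν τ).IsPerfectPIR G :=
    ⟨PIRProtocol.stripeProtocol_isPrivate hκν τ G,
      PIRProtocol.stripeProtocol_recovers hκν hI hτ⟩
  have hrate := PIRProtocol.stripeProtocol_rate (F := F) hk hf hn hκν hmul τ
  refine ⟨le_antisymm (sSup_le ?_) (le_sSup ⟨_, hP, hrate.symm⟩), _, hP,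
    ⟨fun _ => (PIRProtocol.stripeIndices κ ν f).card, fun _ _ => rfl⟩, hrate⟩
  rintro _ ⟨P, hP, rfl⟩
  exact P.rate_le hk hkn hf hC hP
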